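/- Let $p$ be an odd prime, $q$ a power of $p$, $n\ge 1$, and let $V$ be a $2n$-dimensional vector space over the finite field $F_q$ with a non-degenerate alternating form $\langle\,,\rangle$ and a symplectic basis $u_1,\dots,u_n,v_1,\dots,v_n$, i.e. $\langle u_i,v_j\rangle=\delta_{ij}$ and $\langle u_i,u_j\rangle=\langle v_i,v_j\rangle=0$. Let $\mathrm{Sp}\le \mathrm{GL}(V)$ be the isometry group of the form, $M=\mathrm{span}\{u_1,\dots,u_n\}$ and $N=\mathrm{span}\{v_1,\dots,v_n\}$. Let $\mathrm{Sp}^M$ be the pointwise stabilizer of $M$ in $\mathrm{Sp}$, let $\mathrm{Sp}_{M,N}$ be the subgroup of $\mathrm{Sp}$ preserving both $M$ and $N$, let $T$ be the group of all $g\in\mathrm{Sp}_{M,N}$ whose matrix on $M$ relative to $u_1,\dots,u_n$ is upper triangular with $1$'s on the diagonal, and let $H$ be the group of all $g\in \mathrm{Sp}_{M,N}$ for which all $u_i$ and $v_j$ are eigenvectors. Put $U=T\,\mathrm{Sp}^M$ (a $p$-Sylow subgroup of $\mathrm{Sp}$) and $B=UH$. For $1\le i<n$ let $w_i\in\mathrm{Sp}$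 interchange $u_i$ with $u_{i+1}$ and $v_i$ with $v_{i+1}$, fixing the other basis vectors; for $1\le j\le n$ let $c_j\in \mathrm{Sp}$ send $u_j\mapsto v_j$ and $v_j\mapsto -u_j$, fixing the other basis vectors. Let $W_2=\langle w_1,\dots,w_{n-1},c_1,\dots,c_n\rangle$, let $W=W_2H/H\cong W_2/(W_2\cap H)$ be the Weyl group, let $\ell$ be the length function on $W$ with respect to $w_1H,\dots,w_{n-1}H,c_nH$, and choose for each $w\in W$ an element $n_w\in W_2$ with $n_wH=w$. Let $F$ be a field of characteristic $2$ and $\lambda:F_q^+\to F^*$ a non-trivial linear character (one exists exactly when $F$ contains a primitive $p$-th root of unity). In the group algebra $F\mathrm{Sp}$ put $$e=\Big(\sum_{w\in W}(-1)^{\ell(w)}n_w\Big)\sum_{b\in B}b,$$ and let $I=F\mathrm{Sp}\cdot e$ be the (left) Steinberg module. For $v\in V$ and $g\in\mathrm{Sp}$ set $\chi_v(g)=\lambda(\langle gv,v\rangle)$; for $\alpha\in F_q$ the restriction of $\chi_{\alpha v_n}$ to $U$ is a linear character of $U$. For a linear character $\sigma$ of $U$ set $e_\sigma=\sum_{u\in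 U}\sigma(u)^{-1}ue\in I$; in particular $e_1=\sum_{u\in U}ue$. Let $\chi=\chi_{v_n}$ and let $\mathcal T_q$ be a transversal for the action of $\{\pm1\}$ on $F_q^*$. Then the following identity holds in $I$: $$c_n e_\chi=e_1+\sum_{\beta\in\mathcal T_q}\bigl(\lambda(-2\beta)+\lambda(2\beta)\bigr)\,e_{\chi_{\beta v_n}}.$$ -/

import Mathlib

/-! The Steinberg module of a finite symplectic group, with its standard subgroups. -/

namespace SteinbergSp

noncomputable section

/-- The symplectic group `Sp`: all `g ∈ GL(V)` with `⟨g v, g w⟩ = ⟨v, w⟩`. -/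
def Sp {K V : Type*} [Field K] [AddCommGroup V] [Module K V]
    (form : LinearMap.BilinForm K V) : Subgroup (V ≃ₗ[K] V) where
  carrier := {g | ∀ x y, form (g x) (g y) = form x y}
  one_mem' := fun _ _ => rfl
  mul_mem' := by
    intro g h hg hh x y
    exact (hg (h x) (h y)).trans (hh x y)
  inv_mem' := by
    intro g hg x y
    have h := hg (g⁻¹ x) (g⁻¹ y)
    have e : ∀ z, g (g⁻¹ z) = z := fun z => g.apply_symm_apply z
    rw [e, e] at h
    exact h.symm

/-- A symplectic basis `u₁, …, uₙ, v₁, …, vₙ` for an alternating form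
(the existence of such a basis makes the form non-degenerate).
The vectors `uᵢ` are indexed by `Sum.inl`, the vectors `vᵢ` by `Sum.inr`. -/
structure SymplecticBasis {K V : Type*} [Field K] [AddCommGroup V] [Module K V]
    (form : LinearMap.BilinForm K V) (n : ℕ) where
  alt : form.IsAlt
  basis : Module.Basis (Fin n ⊕ Fin n) K V
  form_u_v : ∀ i j, form (basis (Sum.inl i)) (basis (Sum.inr j)) = if i = j then 1 else 0
  form_u_u : ∀ i j, form (basis (Sum.inl i)) (basis (Sum.inl j)) = 0
  form_v_v : ∀ i j, form (basis (Sum.inr i)) (basis (Sum.inr j)) = 0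

namespace SymplecticBasis

variable {K V : Type*} [Field K] [AddCommGroup V] [Module K V]
  {form : LinearMap.BilinForm K V} {n : ℕ} (b : SymplecticBasis form n)

/-- The basis vector `uᵢ`. -/
def u (i : Fin n) : V := b.basis (Sum.inl i)

/-- The basis vector `vᵢ`. -/
def v (i : Fin n) : V := b.basis (Sum.inr i)

theorem form_v_u (i j : Fin n) :
    form (b.basis (Sum.inr i)) (b.basis (Sum.inl j)) = if i = j then -1 else 0 := by
  rw [← b.alt.neg_eq, b.form_u_v]
  by_cases h : i = j
  · simp [h]
  · simp [h, Ne.symm h]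

/-- It is enough to check invariance of the form on the basis. -/
theorem mem_Sp_of_basis (g : V ≃ₗ[K] V)
    (h : ∀ i j, form (g (b.basis i)) (g (b.basis j)) = form (b.basis i) (b.basis j)) :
    g ∈ Sp form := by
  have key : form.compl₁₂ g.toLinearMap g.toLinearMap = form := by
    refine b.basis.ext fun i => b.basis.ext fun j => ?_
    simpa using h i j
  intro x y
  have := LinearMap.congr_fun (LinearMap.congr_fun key x) y
  simpa using this

/-! ### The Weyl group -/

/-- The linear automorphism permuting the `uᵢ` and the `vᵢ` by the permutation `σ`. -/
def permEquiv (σ : Equiv.Perm (Fin n)) : V ≃ₗ[K] V :=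
  b.basis.equiv b.basis (Equiv.sumCongr σ σ)

theorem permEquiv_mem (σ : Equiv.Perm (Fin n)) : b.permEquiv σ ∈ Sp form := by
  refine b.mem_Sp_of_basis _ ?_
  rintro (i | i) (j | j) <;>
    simp [permEquiv, Module.Basis.equiv_apply, b.form_u_u, b.form_v_v, b.form_u_v, b.form_v_u]

/-- `wᵢ = (uᵢ, uᵢ₊₁)(vᵢ, vᵢ₊₁)`, for `1 ≤ i < n`. -/
def w (i : Fin n) (hi : i.val + 1 < n) : Sp form :=
  ⟨b.permEquiv (Equiv.swap i ⟨i.val + 1, hi⟩), b.permEquiv_mem _⟩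

/-- The linear map `uⱼ ↦ vⱼ`, `vⱼ ↦ -uⱼ`, fixing all other basis vectors. -/
def cMap (j : Fin n) : V →ₗ[K] V :=
  b.basis.constr K (Sum.elim
    (fun i => if i = j then b.v j else b.u i)
    (fun i => if i = j then -b.u j else b.v i))

theorem cMap_u (j i : Fin n) :
    b.cMap j (b.basis (Sum.inl i)) = if i = j then b.v j else b.u i := by
  simp [cMap]

theorem cMap_v (j i : Fin n) :
    b.cMap j (b.basis (Sum.inr i)) = if i = j then -b.u j else b.v i := by
  simp [cMap]

theorem cMap_pow_four (j : Fin n) (x : V) :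
    b.cMap j (b.cMap j (b.cMap j (b.cMap j x))) = x := by
  have key : b.cMap j ∘ₗ b.cMap j ∘ₗ b.cMap j ∘ₗ b.cMap j = LinearMap.id := by
    refine b.basis.ext ?_
    rintro (i | i) <;> by_cases h : i = j <;>
      simp [cMap_u, cMap_v, u, v, h]
  exact LinearMap.congr_fun key x

/-- `cⱼ` as a linear automorphism. -/
def cEquiv (j : Fin n) : V ≃ₗ[K] V :=
  LinearEquiv.ofLinearMap (b.cMap j) (b.cMap j ∘ₗ b.cMap j ∘ₗ b.cMap j)
    (LinearMap.ext fun x => b.cMap_pow_four j x) (LinearMap.ext fun x => b.cMap_pow_four j x)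

theorem cEquiv_mem (j : Fin n) : b.cEquiv j ∈ Sp form := by
  refine b.mem_Sp_of_basis _ ?_
  rintro (i | i) (k | k) <;> by_cases hi : i = j <;> by_cases hk : k = j <;>
    simp [cEquiv, cMap_u, cMap_v, u, v, hi, hk, b.form_u_u, b.form_v_v, b.form_u_v, b.form_v_u] <;>
    exact fun h => hk h.symm

/-- `cⱼ ∈ Sp`: `uⱼ ↦ vⱼ`, `vⱼ ↦ -uⱼ`, all other basis vectors are fixed. -/
def c (j : Fin n) : Sp form := ⟨b.cEquiv j, b.cEquiv_mem j⟩

/-- `W₂`, generated by `W₀ = ⟨w₁, …, wₙ₋₁⟩` and `W₁ = ⟨c₁, …, cₙ⟩`. -/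
def W₂ : Subgroup (Sp form) :=
  Subgroup.closure {g | ∃ i hi, g = b.w i hi} ⊔ Subgroup.closure {g | ∃ j, g = b.c j}

/-- The set `{w₁, …, wₙ₋₁, cₙ}` of fundamental reflections. -/
def fundamental : Set (Sp form) :=
  {g | (∃ i hi, g = b.w i hi) ∨ ∃ j : Fin n, j.val + 1 = n ∧ g = b.c j}

/-! ### Subgroups attached to the Witt decomposition -/

/-- `M = span {u₁, …, uₙ}`. -/
def M : Submodule K V := Submodule.span K (Set.range b.u)

/-- `N = span {v₁, …, vₙ}`. -/
def N : Submodule K V := Submodule.span K (Set.range b.v)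

/-- `Sp^M`, the pointwise stabilizer of `M`. -/
def SpM : Subgroup (Sp form) where
  carrier := {g | ∀ x ∈ b.M, g.1 x = x}
  one_mem' := fun _ _ => rfl
  mul_mem' := by
    intro g h hg hh x hx
    exact (congrArg g.1 (hh x hx)).trans (hg x hx)
  inv_mem' := by
    intro g hg x hx
    exact (g.1.symm_apply_eq).2 (hg x hx).symm

/-- `Sp_{M,N}`, the subgroup preserving both `M` and `N`. -/
def SpMN : Subgroup (Sp form) where
  carrier := {g | b.M.map g.1.toLinearMap = b.M ∧ b.N.map g.1.toLinearMap = b.N}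
  one_mem' := ⟨Submodule.map_id _, Submodule.map_id _⟩
  mul_mem' := by
    intro g h hg hh
    have e : ((g * h : Sp form).1).toLinearMap = g.1.toLinearMap ∘ₗ h.1.toLinearMap := rfl
    constructor
    · rw [e, Submodule.map_comp, hh.1, hg.1]
    · rw [e, Submodule.map_comp, hh.2, hg.2]
  inv_mem' := by
    intro g hg
    have e : ((g⁻¹ : Sp form).1).toLinearMap ∘ₗ g.1.toLinearMap = LinearMap.id :=
      LinearMap.ext fun x => g.1.symm_apply_apply x
    constructor
    · conv_lhs => rw [← hg.1]
      rw [← Submodule.map_comp, e, Submodule.map_id]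
    · conv_lhs => rw [← hg.2]
      rw [← Submodule.map_comp, e, Submodule.map_id]

/-- `span {uᵢ : i < j}`. -/
def below (j : Fin n) : Submodule K V := Submodule.span K (b.u '' Set.Iio j)

theorem map_below_mem {f : V →ₗ[K] V} {j : Fin n}
    (hf : ∀ i < j, f (b.u i) - b.u i ∈ b.below i) {x : V} (hx : x ∈ b.below j) :
    f x ∈ b.below j := by
  have hle : b.below j ≤ (b.below j).comap f := by
    refine Submodule.span_le.2 ?_
    rintro _ ⟨i, hi, rfl⟩
    have h1 : b.below i ≤ b.below j :=
      Submodule.span_mono (Set.image_mono (Set.Iio_subset_Iio (le_of_lt hi)))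
    have h2 : b.u i ∈ b.below j := Submodule.subset_span ⟨i, hi, rfl⟩
    have h3 := (b.below j).add_mem (h1 (hf i hi)) h2
    simpa using h3
  exact hle hx

/-- `T`: the elements of `Sp_{M,N}` whose matrix on `M` with respect to `u₁, …, uₙ` is upper
triangular with ones on the diagonal. -/
def T : Subgroup (Sp form) where
  carrier := {g | g ∈ b.SpMN ∧ ∀ j, g.1 (b.u j) - b.u j ∈ b.below j}
  one_mem' := ⟨one_mem _, fun j => by simp⟩
  mul_mem' := by
    rintro g h ⟨hg, hg'⟩ ⟨hh, hh'⟩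
    refine ⟨mul_mem hg hh, fun j => ?_⟩
    have h1 : g.1 (h.1 (b.u j) - b.u j) ∈ b.below j :=
      b.map_below_mem (f := g.1.toLinearMap) (fun i _ => hg' i) (hh' j)
    have h2 := (b.below j).add_mem h1 (hg' j)
    rw [map_sub, sub_add_sub_cancel] at h2
    exact h2
  inv_mem' := by
    rintro g ⟨hg, hg'⟩
    refine ⟨inv_mem hg, fun j => ?_⟩
    induction j using WellFoundedLT.induction with
    | ind j ih =>
      have h1 : (g⁻¹).1 (g.1 (b.u j) - b.u j) ∈ b.below j :=
        b.map_below_mem (f := (g⁻¹).1.toLinearMap) (fun i hi => ih i hi) (hg' j)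
      have e : (g⁻¹).1 (g.1 (b.u j)) = b.u j := g.1.symm_apply_apply _
      rw [map_sub, e] at h1
      have h2 := (b.below j).neg_mem h1
      rwa [neg_sub] at h2

/-- The Sylow subgroup `U = T ⋉ Sp^M`. -/
def U : Subgroup (Sp form) := b.T ⊔ b.SpM

/-- `H`: the elements of `Sp_{M,N}` for which all `uᵢ` and `vᵢ` are eigenvectors. -/
def H : Subgroup (Sp form) where
  carrier := {g | g ∈ b.SpMN ∧ ∀ i, ∃ a : K, g.1 (b.basis i) = a • b.basis i}
  one_mem' := ⟨one_mem _, fun i => ⟨1, by simp⟩⟩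
  mul_mem' := by
    rintro g h ⟨hg, hg'⟩ ⟨hh, hh'⟩
    refine ⟨mul_mem hg hh, fun i => ?_⟩
    obtain ⟨x, hx⟩ := hg' i
    obtain ⟨y, hy⟩ := hh' i
    refine ⟨y * x, ?_⟩
    change g.1 (h.1 (b.basis i)) = _
    rw [hy, map_smul, hx, smul_smul]
  inv_mem' := by
    rintro g ⟨hg, hg'⟩
    refine ⟨inv_mem hg, fun i => ?_⟩
    obtain ⟨x, hx⟩ := hg' i
    have hx0 : x ≠ 0 := by
      rintro rfl
      rw [zero_smul] at hx
      exact b.basis.ne_zero i (g.1.map_eq_zero_iff.1 hx)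
    refine ⟨x⁻¹, ?_⟩
    refine (g.1.symm_apply_eq).2 ?_
    rw [map_smul, hx, smul_smul, inv_mul_cancel₀ hx0, one_smul]

/-- `B = U ⋊ H`. -/
def B : Subgroup (Sp form) := b.U ⊔ b.H

/-- The Weyl group `W = W₂H/H`, in the form `W₂/(W₂ ∩ H)`. -/
abbrev Weyl : Type _ := b.W₂ ⧸ b.H.subgroupOf b.W₂

/-- `ℓ(w) = ℓ(wH)` for `w ∈ W₂`: the length of a shortest word in the letters
`w₁H, …, wₙ₋₁H, cₙH` which is equal to `wH`. -/
def length (g : b.W₂) : ℕ :=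
  sInf {k | ∃ L : List (Sp form),
    L.length = k ∧ (∀ s ∈ L, s ∈ b.fundamental) ∧ (g : Sp form)⁻¹ * L.prod ∈ b.H}

end SymplecticBasis

/-! ### The Steinberg module -/

section Steinberg

variable {K V : Type*} [Field K] [AddCommGroup V] [Module K V]

instance finite_Sp [Finite K] [Module.Finite K V] (form : LinearMap.BilinForm K V) :
    Finite (Sp form) := by
  have : Finite V := Module.finite_of_finite K
  have : Finite (V ≃ₗ[K] V) := DFunLike.finite _
  infer_instance

attribute [local instance] Fintype.ofFinite

variable [Finite K] [Module.Finite K V] {form : LinearMap.BilinForm K V} {n : ℕ}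
  (F : Type*) [Field F] (b : SymplecticBasis form n) (rep : b.Weyl → b.W₂)

/-- The element `e = (∑_{w ∈ W} (-1)^{ℓ(w)} n_w) ∑_{x ∈ B} x` of the group algebra `F Sp`, where
`n_w = rep w` is a representative in `W₂` of the element `w` of the Weyl group. -/
def steinbergElement : MonoidAlgebra F (Sp form) :=
  (∑ w : b.Weyl, (-1 : F) ^ b.length (rep w) • MonoidAlgebra.of F (Sp form) (rep w)) *
    ∑ x : b.B, MonoidAlgebra.of F (Sp form) x

/-- The Steinberg module `I = F Sp · e`, a left ideal of the group algebra. -/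
def steinbergModule : Ideal (MonoidAlgebra F (Sp form)) :=
  Ideal.span {steinbergElement F b rep}

/-- The generator `e`, as an element of `I`. -/
def gen : steinbergModule F b rep :=
  ⟨steinbergElement F b rep, Ideal.subset_span rfl⟩

variable {F}

/-- `e_σ = ∑_{x ∈ U} σ(x)⁻¹ x e ∈ I`. -/
def eSigma (σ : Sp form → F) : steinbergModule F b rep :=
  ∑ x : b.U, (σ x)⁻¹ • (MonoidAlgebra.of F (Sp form) x • gen F b rep)

end Steinberg

/-- `χ_v(g) = λ(⟨g v, v⟩)`. -/
def chi {K V F : Type*} [Field K] [AddCommGroup V] [Module K V] [Field F]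
    {form : LinearMap.BilinForm K V} (lam : AddChar K F) (v : V) (g : Sp form) : F :=
  lam (form (g.1 v) v)

/-- `R` is a set of representatives for the orbits of `{1, -1}` on `K \ {0}`. -/
def IsSignRepresentatives {K : Type*} [Field K] (R : Finset K) : Prop :=
  0 ∉ R ∧ ∀ x : K, x ≠ 0 → ∃! y, y ∈ R ∧ (y = x ∨ y = -x)

end

end SteinbergSp

namespace SteinbergSp

namespace SymplecticBasis

/-! ### The unipotent group `U` as the unipotent stabilizer of a flag in `M` -/

section Unipotent

variable {K V : Type*} [Field K] [AddCommGroup V] [Module K V]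
  {form : LinearMap.BilinForm K V} {n : ℕ} (b : SymplecticBasis form n)

/-! Write `v`, `u`, `c` for the basis vectors and reflection with the last index, `x(t)` for the
long root element `v ↦ v + t u`, and `R` for the set of `g ∈ U` with `⟨g v, v⟩ = 0`. Each element of
`U` is uniquely `r x(t)` with `r ∈ R`, and `c` normalizes `R`. The characters `χ_{βv}` are trivial
on `R` and take `x(t)` to `λ(β² t)`, so each `e_σ` in the identity is the sum over `R` times a
combination of the `x(t) e` (`coe_eSigma`). Since `c` commutes with the sum over `R`
(`c_mul_radicalSum`), everything reduces to rank one.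

There, in characteristic 2, `c e = e` and `c x(t) e = e + x(-1/t) e` for `t ≠ 0`
(`c_mul_longRoot_mul_steinbergElement`). The second relation comes from `e = P + cP`, where `P` is
fixed by `H` and by all `x(t)`, together with the relation in the rank one group for `c x(t) c`. As
`∑ λ(-t) = 0`, the left side becomes `∑_{t ≠ 0} λ(1/t) x(t) e`.

On the right, pairing `β` with `-β` and taking `e_1` as the term `β = 0` gives `∑_β ∑_t λ(2β - β² t)
x(t) e`. The coefficient of `x(t) e` is a quadratic Gauss sum. It vanishes for `t = 0`. For `t ≠ 0`,
completing the square gives `λ(1/t) ∑ λ(-β² t)`, and this last sum is `1` because the terms for `±β`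
cancel in characteristic 2. -/

theorem Sp_mul_apply (g h : Sp form) (x : V) : (g * h).1 x = g.1 (h.1 x) := rfl

theorem Sp_inv_apply_apply (g : Sp form) (x : V) : (g⁻¹).1 (g.1 x) = x := g.1.symm_apply_apply x

theorem Sp_apply_inv_apply (g : Sp form) (x : V) : g.1 ((g⁻¹).1 x) = x := g.1.apply_symm_apply x

/-- An element of `Sp` moves from one argument of the form to the other as its inverse. -/
theorem form_apply_left (g : Sp form) (x y : V) : form (g.1 x) y = form x ((g⁻¹).1 y) := by
  conv_lhs => rw [← Sp_apply_inv_apply g y]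
  exact g.2 _ _

theorem form_uv (i j : Fin n) : form (b.u i) (b.v j) = if i = j then 1 else 0 := b.form_u_v i j

theorem form_uu (i j : Fin n) : form (b.u i) (b.u j) = 0 := b.form_u_u i j

theorem form_vv (i j : Fin n) : form (b.v i) (b.v j) = 0 := b.form_v_v i j

theorem u_mem_M (i : Fin n) : b.u i ∈ b.M := Submodule.subset_span ⟨i, rfl⟩

theorem v_mem_N (i : Fin n) : b.v i ∈ b.N := Submodule.subset_span ⟨i, rfl⟩

theorem below_le_M (j : Fin n) : b.below j ≤ b.M := by
  refine Submodule.span_mono ?_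
  rintro _ ⟨i, _, rfl⟩
  exact ⟨i, rfl⟩

theorem form_eq_zero_of_mem_M {x y : V} (hx : x ∈ b.M) (hy : y ∈ b.M) : form x y = 0 := by
  refine Submodule.span_induction₂ (p := fun x y _ _ => form x y = 0) ?_ ?_ ?_ ?_ ?_ ?_ ?_ hx hy
  · rintro _ _ ⟨i, rfl⟩ ⟨j, rfl⟩
    exact b.form_uu i j
  all_goals simp +contextual

theorem form_eq_zero_of_mem_N {x y : V} (hx : x ∈ b.N) (hy : y ∈ b.N) : form x y = 0 := by
  refine Submodule.span_induction₂ (p := fun x y _ _ => form x y = 0) ?_ ?_ ?_ ?_ ?_ ?_ ?_ hx hy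
  · rintro _ _ ⟨i, rfl⟩ ⟨j, rfl⟩
    exact b.form_vv i j
  all_goals simp +contextual

theorem form_below_v {j k : Fin n} (h : j ≤ k) {x : V} (hx : x ∈ b.below j) :
    form x (b.v k) = 0 := by
  refine Submodule.span_induction (p := fun x _ => form x (b.v k) = 0) ?_ ?_ ?_ ?_ hx
  · rintro _ ⟨i, hi, rfl⟩
    rw [b.form_uv, if_neg (ne_of_lt (lt_of_lt_of_le hi h))]
  all_goals simp +contextual

/-- Coordinates with respect to a symplectic basis, in terms of the form. -/
theorem sum_form_smul (x : V) :
    x = ∑ i, form x (b.v i) • b.u i + ∑ i, form (b.u i) x • b.v i := by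
  have key : LinearMap.id = ∑ i, (form.flip (b.v i)).smulRight (b.u i) +
      ∑ i, (form (b.u i)).smulRight (b.v i) := by
    refine b.basis.ext ?_
    rintro (j | j)
    · change b.u j = _
      rw [show b.basis (Sum.inl j) = b.u j from rfl]
      simp [b.form_uv, b.form_uu]
    · change b.v j = _
      rw [show b.basis (Sum.inr j) = b.v j from rfl]
      simp [b.form_uv, b.form_vv]
  have := LinearMap.congr_fun key x
  simpa using this

theorem eq_zero_of_form {x : V} (h : ∀ i, form x (b.basis i) = 0) : x = 0 := by
  rw [b.sum_form_smul x]
  have h1 : ∀ i, form x (b.v i) = 0 := fun i => h (Sum.inr i)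
  have h2 : ∀ i, form (b.u i) x = 0 := fun i => by
    rw [← b.alt.neg_eq]
    exact neg_eq_zero.2 (h (Sum.inl i))
  simp [h1, h2]

theorem map_mem_of_span {m : Submodule K V} {s : Set V} (f : V →ₗ[K] V)
    (h : ∀ x ∈ s, f x ∈ m) {x : V} (hx : x ∈ Submodule.span K s) : f x ∈ m :=
  (Submodule.span_le (p := m.comap f)).2 h hx

theorem map_equiv_eq_of_le [Module.Finite K V] {m : Submodule K V} (g : V ≃ₗ[K] V)
    (h : ∀ x ∈ m, g x ∈ m) : m.map g.toLinearMap = m := by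
  refine Submodule.eq_of_le_of_finrank_eq ?_ (LinearEquiv.finrank_map_eq g m)
  rintro _ ⟨x, hx, rfl⟩
  exact h x hx

/-- The stabilizer of the flag `⟨u₁⟩ ≤ ⟨u₁, u₂⟩ ≤ … ≤ M`, acting trivially on its factors. -/
def flagUnipotent : Subgroup (Sp form) where
  carrier := {g | ∀ j, g.1 (b.u j) - b.u j ∈ b.below j}
  one_mem' := fun j => by simp
  mul_mem' := by
    intro g h hg' hh' j
    have h1 : g.1 (h.1 (b.u j) - b.u j) ∈ b.below j :=
      b.map_below_mem (f := g.1.toLinearMap) (fun i _ => hg' i) (hh' j)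
    have h2 := (b.below j).add_mem h1 (hg' j)
    rw [map_sub, sub_add_sub_cancel] at h2
    exact h2
  inv_mem' := by
    intro g hg' j
    induction j using WellFoundedLT.induction with
    | ind j ih =>
      have h1 : (g⁻¹).1 (g.1 (b.u j) - b.u j) ∈ b.below j :=
        b.map_below_mem (f := (g⁻¹).1.toLinearMap) (fun i hi => ih i hi) (hg' j)
      rw [map_sub, Sp_inv_apply_apply] at h1
      have h2 := (b.below j).neg_mem h1
      rwa [neg_sub] at h2

theorem apply_u_mem_M {g : Sp form} (hg : g ∈ b.flagUnipotent) (j : Fin n) :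
    g.1 (b.u j) ∈ b.M := by
  have := b.M.add_mem (b.below_le_M j (hg j)) (b.u_mem_M j)
  simpa using this

theorem apply_mem_M {g : Sp form} (hg : g ∈ b.flagUnipotent) {x : V} (hx : x ∈ b.M) :
    g.1 x ∈ b.M := by
  refine map_mem_of_span g.1.toLinearMap ?_ hx
  rintro _ ⟨i, rfl⟩
  exact b.apply_u_mem_M hg i

/-- The Levi component of an endomorphism: `uⱼ ↦ g uⱼ`, and `vⱼ` goes to the component of `g vⱼ`
in `N`. -/
noncomputable def leviMap (g : Sp form) : V →ₗ[K] V :=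
  b.basis.constr K (Sum.elim (fun j => g.1 (b.u j))
    (fun j => ∑ i, form (b.u i) (g.1 (b.v j)) • b.v i))

theorem leviMap_u (g : Sp form) (j : Fin n) :
    b.leviMap g (b.u j) = g.1 (b.u j) := by
  rw [leviMap, u, Module.Basis.constr_basis]
  rfl

theorem leviMap_v (g : Sp form) (j : Fin n) :
    b.leviMap g (b.v j) = ∑ i, form (b.u i) (g.1 (b.v j)) • b.v i := by
  rw [leviMap, v, Module.Basis.constr_basis]
  rfl

theorem leviMap_v_mem (g : Sp form) (j : Fin n) : b.leviMap g (b.v j) ∈ b.N := by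
  rw [leviMap_v]
  exact Submodule.sum_mem _ fun i _ => b.N.smul_mem _ (b.v_mem_N i)

theorem form_leviMap_v {g : Sp form} {x : V} (hx : x ∈ b.M) (j : Fin n) :
    form x (b.leviMap g (b.v j)) = form x (g.1 (b.v j)) := by
  conv_rhs => rw [b.sum_form_smul (g.1 (b.v j)), map_add, ← leviMap_v]
  rw [right_eq_add]
  refine b.form_eq_zero_of_mem_M hx ?_
  exact Submodule.sum_mem _ fun i _ => b.M.smul_mem _ (b.u_mem_M i)

/-- The part of `g vⱼ` that is discarded lies in `M`. Since `g` maps `M` to itself and `M` is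
isotropic, pairings between the `uᵢ` and `vⱼ` do not change; those among the `vⱼ` vanish because `N`
is isotropic. -/
theorem form_leviMap {g : Sp form} (hg : g ∈ b.flagUnipotent) (i j : Fin n ⊕ Fin n) :
    form (b.leviMap g (b.basis i)) (b.leviMap g (b.basis j)) =
      form (b.basis i) (b.basis j) := by
  have huv : ∀ i j, form (b.leviMap g (b.u i)) (b.leviMap g (b.v j)) = form (b.u i) (b.v j) := by
    intro i j
    rw [leviMap_u, b.form_leviMap_v (b.apply_u_mem_M hg i), g.2]
  rcases i with i | i <;> rcases j with j | j
  · change form (b.leviMap g (b.u i)) (b.leviMap g (b.u j)) = form (b.u i) (b.u j)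
    rw [leviMap_u, leviMap_u, g.2]
  · exact huv i j
  · change form (b.leviMap g (b.v i)) (b.leviMap g (b.u j)) = form (b.v i) (b.u j)
    rw [← b.alt.neg_eq, huv, b.alt.neg_eq]
  · change form (b.leviMap g (b.v i)) (b.leviMap g (b.v j)) = form (b.v i) (b.v j)
    rw [b.form_vv, b.form_eq_zero_of_mem_N (b.leviMap_v_mem g i) (b.leviMap_v_mem g j)]

theorem leviMap_injective {g : Sp form} (hg : g ∈ b.flagUnipotent) :
    Function.Injective (b.leviMap g) := by
  have key : form.compl₁₂ (b.leviMap g) (b.leviMap g) = form := by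
    refine b.basis.ext fun i => b.basis.ext fun j => ?_
    simpa using b.form_leviMap hg i j
  rw [injective_iff_map_eq_zero]
  intro x hx
  refine b.eq_zero_of_form fun i => ?_
  have := LinearMap.congr_fun (LinearMap.congr_fun key x) (b.basis i)
  simpa [hx] using this.symm

theorem exists_mem_T_eq_on_M [Module.Finite K V] {g : Sp form} (hg : g ∈ b.flagUnipotent) :
    ∃ t ∈ b.T, ∀ x ∈ b.M, t.1 x = g.1 x := by
  let f : V ≃ₗ[K] V := LinearEquiv.ofInjectiveEndo (b.leviMap g) (b.leviMap_injective hg)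
  have hf : ∀ x, f x = b.leviMap g x := fun x => rfl
  have hfu : ∀ j, f (b.u j) = g.1 (b.u j) := fun j => b.leviMap_u g j
  refine ⟨⟨f, b.mem_Sp_of_basis f fun i j => b.form_leviMap hg i j⟩, ⟨⟨?_, ?_⟩, ?_⟩, ?_⟩
  · refine map_equiv_eq_of_le f fun x hx => map_mem_of_span f.toLinearMap ?_ hx
    rintro _ ⟨i, rfl⟩
    change f (b.u i) ∈ b.M
    rw [hfu]
    exact b.apply_u_mem_M hg i
  · refine map_equiv_eq_of_le f fun x hx => map_mem_of_span f.toLinearMap ?_ hx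
    rintro _ ⟨i, rfl⟩
    exact b.leviMap_v_mem g i
  · intro j
    change f (b.u j) - b.u j ∈ b.below j
    rw [hfu]
    exact hg j
  · intro x hx
    have : Set.EqOn f.toLinearMap g.1.toLinearMap (Set.range b.u) := by
      rintro _ ⟨i, rfl⟩
      exact hfu i
    exact LinearMap.eqOn_span this hx

/-- An element of the flag group agrees on `M` with its Levi component in `T`, and the quotient of
the two fixes `M` pointwise. Membership in `U` thus becomes a condition on the images of the `uⱼ`
alone. -/
theorem U_eq_flagUnipotent [Module.Finite K V] : b.U = b.flagUnipotent := by
  apply le_antisymm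
  · refine sup_le (fun g hg => hg.2) fun g hg j => ?_
    rw [hg _ (b.u_mem_M j), sub_self]
    exact Submodule.zero_mem _
  · intro g hg
    obtain ⟨t, ht, h⟩ := b.exists_mem_T_eq_on_M hg
    have hs : t⁻¹ * g ∈ b.SpM := fun x hx => by
      rw [Sp_mul_apply, ← h x hx, Sp_inv_apply_apply]
    have := mul_mem (Subgroup.mem_sup_left (T := b.SpM) ht) (Subgroup.mem_sup_right (S := b.T) hs)
    rwa [mul_inv_cancel_left] at this

/-! ### The decomposition of `U` attached to the last fundamental reflection -/

theorem c_u_self (j : Fin n) : (b.c j).1 (b.u j) = b.v j :=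
  (b.cMap_u j j).trans (if_pos rfl)

theorem c_v_self (j : Fin n) : (b.c j).1 (b.v j) = -b.u j :=
  (b.cMap_v j j).trans (if_pos rfl)

theorem c_u_of_ne {i j : Fin n} (h : i ≠ j) : (b.c j).1 (b.u i) = b.u i :=
  (b.cMap_u j i).trans (if_neg h)

theorem c_v_of_ne {i j : Fin n} (h : i ≠ j) : (b.c j).1 (b.v i) = b.v i :=
  (b.cMap_v j i).trans (if_neg h)

theorem c_inv_u_self (j : Fin n) : ((b.c j)⁻¹).1 (b.u j) = -b.v j := by
  have := Sp_inv_apply_apply (b.c j) (-b.v j)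
  rwa [map_neg, c_v_self, neg_neg] at this

theorem c_inv_v_self (j : Fin n) : ((b.c j)⁻¹).1 (b.v j) = b.u j := by
  have := Sp_inv_apply_apply (b.c j) (b.u j)
  rwa [c_u_self] at this

theorem c_inv_u_of_ne {i j : Fin n} (h : i ≠ j) : ((b.c j)⁻¹).1 (b.u i) = b.u i := by
  have := Sp_inv_apply_apply (b.c j) (b.u i)
  rwa [b.c_u_of_ne h] at this

theorem c_apply_of_mem_below {j k : Fin n} (h : j ≤ k) {x : V} (hx : x ∈ b.below j) :
    (b.c k).1 x = x := by
  have : Set.EqOn (b.c k).1.toLinearMap (LinearMap.id (R := K)) (b.u '' Set.Iio j) := by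
    rintro _ ⟨i, hi, rfl⟩
    exact b.c_u_of_ne (ne_of_lt (lt_of_lt_of_le hi h))
  exact LinearMap.eqOn_span this hx

/-- The transvection `x ↦ x + t ⟨a, x⟩ a`. -/
def transvection (halt : form.IsAlt) (a : V) (t : K) : Sp form :=
  ⟨{ toFun := fun x => x + (t * form a x) • a
     invFun := fun x => x - (t * form a x) • a
     map_add' := fun x y => by simp only [map_add]; module
     map_smul' := fun r x => by simp only [map_smul, smul_eq_mul, RingHom.id_apply]; module
     left_inv := fun x => by simp [halt.self_eq_zero]
     right_inv := fun x => by simp [halt.self_eq_zero] }, by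
    intro x y
    change form (x + (t * form a x) • a) (y + (t * form a y) • a) = form x y
    have h : form x a = - form a x := (halt.neg_eq a x).symm
    simp only [map_add, map_smul, LinearMap.add_apply, LinearMap.smul_apply, smul_eq_mul,
      halt.self_eq_zero, h]
    ring⟩

theorem transvection_apply (halt : form.IsAlt) (a : V) (t : K) (x : V) :
    (transvection halt a t).1 x = x + (t * form a x) • a := rfl

theorem transvection_zero (halt : form.IsAlt) (a : V) : transvection halt a (0 : K) = 1 := by
  apply Subtype.ext
  ext x
  simp [transvection_apply]

/-- The root subgroup of the long root: `vⱼ ↦ vⱼ + t uⱼ`, fixing all other basis vectors. -/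
noncomputable def longRoot (j : Fin n) (t : K) : Sp form := transvection b.alt (b.u j) t

theorem longRoot_apply (j : Fin n) (t : K) (x : V) :
    (b.longRoot j t).1 x = x + (t * form (b.u j) x) • b.u j := rfl

theorem longRoot_zero (j : Fin n) : b.longRoot j 0 = 1 := transvection_zero b.alt _

theorem longRoot_mul_neg (j : Fin n) (t : K) : b.longRoot j t * b.longRoot j (-t) = 1 := by
  apply Subtype.ext
  ext x
  change (b.longRoot j t).1 ((b.longRoot j (-t)).1 x) = x
  simp [longRoot_apply, b.form_uu]

theorem longRoot_neg_mul (j : Fin n) (t : K) : b.longRoot j (-t) * b.longRoot j t = 1 := by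
  simpa using b.longRoot_mul_neg j (-t)

theorem longRoot_apply_of_mem_M (j : Fin n) (t : K) {x : V} (hx : x ∈ b.M) :
    (b.longRoot j t).1 x = x := by
  rw [longRoot_apply, b.form_eq_zero_of_mem_M (b.u_mem_M j) hx, mul_zero, zero_smul, add_zero]

theorem longRoot_u (j i : Fin n) (t : K) : (b.longRoot j t).1 (b.u i) = b.u i :=
  b.longRoot_apply_of_mem_M j t (b.u_mem_M i)

theorem longRoot_v_self (j : Fin n) (t : K) : (b.longRoot j t).1 (b.v j) = b.v j + t • b.u j := by
  rw [longRoot_apply, b.form_uv, if_pos rfl, mul_one]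

theorem longRoot_v_of_ne {i j : Fin n} (h : i ≠ j) (t : K) :
    (b.longRoot j t).1 (b.v i) = b.v i := by
  rw [longRoot_apply, b.form_uv, if_neg h.symm, mul_zero, zero_smul, add_zero]

theorem longRoot_mem_SpM (j : Fin n) (t : K) : b.longRoot j t ∈ b.SpM :=
  fun _ hx => b.longRoot_apply_of_mem_M j t hx

theorem longRoot_mem_U (j : Fin n) (t : K) : b.longRoot j t ∈ b.U :=
  Subgroup.mem_sup_right (b.longRoot_mem_SpM j t)

/-- Move `g` to the other side: `g⁻¹ uᵢ - uᵢ` involves only `uₖ` with `k < i ≤ last`, all orthogonal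
to the last `v`. -/
theorem form_u_apply_v_last {g : Sp form} (hg : g ∈ b.flagUnipotent) {last : Fin n}
    (hlast : last.val + 1 = n) (i : Fin n) :
    form (b.u i) (g.1 (b.v last)) = if i = last then 1 else 0 := by
  have hz : (g⁻¹).1 (b.u i) - b.u i ∈ b.below i := b.flagUnipotent.inv_mem hg i
  have hi : i ≤ last := Fin.le_def.2 (by omega)
  have h := b.form_below_v hi hz
  rw [map_sub, LinearMap.sub_apply, sub_eq_zero] at h
  rw [← b.form_uv, ← h, form_apply_left, inv_inv]

theorem form_apply_u_v {g : Sp form} (hg : g ∈ b.flagUnipotent) (j : Fin n) :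
    form (g.1 (b.u j)) (b.v j) = 1 := by
  have h := b.form_below_v le_rfl (hg j)
  rw [map_sub, LinearMap.sub_apply, sub_eq_zero] at h
  rw [h, b.form_uv, if_pos rfl]

/-- The elements of `U` in the unipotent radical of the parabolic subgroup generated by `B` and
the last fundamental reflection. -/
def radical (last : Fin n) : Set (Sp form) :=
  {g | g ∈ b.U ∧ form (g.1 (b.v last)) (b.v last) = 0}

/-- Hence `g ↦ ⟨g v, v⟩` recovers the root subgroup factor of an element of `U`. -/
theorem form_mul_longRoot [Module.Finite K V] {g : Sp form} (hg : g ∈ b.U) (j : Fin n) (t : K) :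
    form ((g * b.longRoot j t).1 (b.v j)) (b.v j) = form (g.1 (b.v j)) (b.v j) + t := by
  rw [U_eq_flagUnipotent] at hg
  rw [Sp_mul_apply, longRoot_v_self, map_add, map_smul, map_add, map_smul, LinearMap.add_apply,
    LinearMap.smul_apply, b.form_apply_u_v hg, smul_eq_mul, mul_one]

/-- For elements of the radical, the last `v` satisfies the same unipotency condition as the last
`u`. This symmetry is what lets `c` normalize the radical. -/
theorem apply_v_sub_mem_below {g : Sp form} (hg : g ∈ b.flagUnipotent) {last : Fin n}
    (hlast : last.val + 1 = n) (h0 : form (g.1 (b.v last)) (b.v last) = 0) :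
    g.1 (b.v last) - b.v last ∈ b.below last := by
  have h := b.sum_form_smul (g.1 (b.v last))
  simp only [b.form_u_apply_v_last hg hlast, ite_smul, one_smul, zero_smul,
    Finset.sum_ite_eq', Finset.mem_univ, if_true] at h
  rw [h, add_sub_cancel_right]
  refine Submodule.sum_mem _ fun i _ => ?_
  rcases eq_or_ne i last with rfl | hi
  · rw [h0, zero_smul]
    exact Submodule.zero_mem _
  · refine Submodule.smul_mem _ _ (Submodule.subset_span ⟨i, ?_, rfl⟩)
    exact lt_of_le_of_ne (Fin.le_def.2 (by omega)) hi

/-- Up to sign `c` exchanges the last `u` and `v`, and it fixes the span of the earlier `uᵢ`. The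
flag condition at the last `u` turns into the one for `g v`, and the vanishing of `⟨g v, v⟩` turns
into that of `⟨g u, u⟩`, which holds because `M` is isotropic. -/
theorem conj_c_mem_radical [Module.Finite K V] {last : Fin n} (hlast : last.val + 1 = n)
    {g : Sp form} (hg : g ∈ b.radical last) :
    b.c last * g * (b.c last)⁻¹ ∈ b.radical last := by
  obtain ⟨hU, h0⟩ := hg
  rw [U_eq_flagUnipotent] at hU
  refine ⟨?_, ?_⟩
  · rw [U_eq_flagUnipotent]
    intro j
    rw [Sp_mul_apply, Sp_mul_apply]
    rcases eq_or_ne j last with rfl | hj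
    · rw [c_inv_u_self, map_neg, map_neg]
      have h1 := b.apply_v_sub_mem_below hU hlast h0
      have h2 := b.c_apply_of_mem_below le_rfl h1
      rw [map_sub, c_v_self] at h2
      have h3 := (b.below j).neg_mem h1
      rw [← h2] at h3
      convert h3 using 1
      abel
    · have h2 := b.c_apply_of_mem_below (k := last) (Fin.le_def.2 (by omega)) (hU j)
      rw [map_sub, b.c_u_of_ne hj] at h2
      rw [b.c_inv_u_of_ne hj, h2]
      exact hU j
  · rw [mul_assoc, Sp_mul_apply, form_apply_left, Sp_mul_apply, c_inv_v_self]
    exact b.form_eq_zero_of_mem_M (b.apply_u_mem_M hU last) (b.u_mem_M last)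

/-- Every element of `U` is uniquely the product of an element of the radical and one of the root
subgroup. -/
noncomputable def radicalProdEquiv [Module.Finite K V] (last : Fin n) :
    b.radical last × K ≃ b.U where
  toFun p := ⟨p.1.1 * b.longRoot last p.2, mul_mem p.1.2.1 (b.longRoot_mem_U last p.2)⟩
  invFun g := ⟨⟨g.1 * b.longRoot last (-form (g.1.1 (b.v last)) (b.v last)),
    mul_mem g.2 (b.longRoot_mem_U _ _), by
      rw [b.form_mul_longRoot g.2, add_neg_cancel]⟩, form (g.1.1 (b.v last)) (b.v last)⟩
  left_inv := by
    rintro ⟨⟨g, hg, h0⟩, t⟩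
    have h : form ((g * b.longRoot last t).1 (b.v last)) (b.v last) = t := by
      rw [b.form_mul_longRoot hg, h0, zero_add]
    refine Prod.ext (Subtype.ext ?_) h
    dsimp only
    rw [h, mul_assoc, longRoot_mul_neg, mul_one]
  right_inv := by
    rintro ⟨g, hg⟩
    apply Subtype.ext
    dsimp only
    rw [mul_assoc, longRoot_neg_mul, mul_one]

end Unipotent

end SymplecticBasis

end SteinbergSp

namespace SteinbergSp

namespace SymplecticBasis

/-! ### Monomial action of `W₂`, and the rank one relation -/

section Monomial

variable {K V : Type*} [Field K] [AddCommGroup V] [Module K V]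
  {form : LinearMap.BilinForm K V} {n : ℕ} (b : SymplecticBasis form n)

theorem v_notMem_M (i : Fin n) : b.v i ∉ b.M := fun h => by
  have := b.form_eq_zero_of_mem_M (b.u_mem_M i) h
  rw [b.form_uv, if_pos rfl] at this
  exact one_ne_zero this

/-- The elements of `Sp` permuting the hyperbolic pairs of lines `Kuᵢ`, `Kvᵢ`. -/
def monomial : Submonoid (Sp form) where
  carrier := {g | ∀ i, ∃ k, ∃ r s : K, r ≠ 0 ∧ s ≠ 0 ∧
    ((g.1 (b.u i) = r • b.u k ∧ g.1 (b.v i) = s • b.v k) ∨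
      (g.1 (b.u i) = r • b.v k ∧ g.1 (b.v i) = s • b.u k))}
  one_mem' := fun i => ⟨i, 1, 1, one_ne_zero, one_ne_zero, Or.inl ⟨by simp, by simp⟩⟩
  mul_mem' := by
    intro g h hg hh i
    obtain ⟨k, r, s, hr, hs, hk⟩ := hh i
    obtain ⟨l, r', s', hr', hs', hl⟩ := hg k
    simp only [Sp_mul_apply]
    rcases hk with ⟨h1, h2⟩ | ⟨h1, h2⟩ <;> rcases hl with ⟨h3, h4⟩ | ⟨h3, h4⟩ <;>
      rw [h1, h2, map_smul, map_smul, h3, h4, smul_smul, smul_smul]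
    · exact ⟨l, _, _, mul_ne_zero hr hr', mul_ne_zero hs hs', Or.inl ⟨rfl, rfl⟩⟩
    · exact ⟨l, _, _, mul_ne_zero hr hr', mul_ne_zero hs hs', Or.inr ⟨rfl, rfl⟩⟩
    · exact ⟨l, _, _, mul_ne_zero hr hs', mul_ne_zero hs hr', Or.inr ⟨rfl, rfl⟩⟩
    · exact ⟨l, _, _, mul_ne_zero hr hs', mul_ne_zero hs hr', Or.inl ⟨rfl, rfl⟩⟩

theorem w_mem_monomial (i : Fin n) (hi : i.val + 1 < n) : b.w i hi ∈ b.monomial := by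
  intro j
  refine ⟨Equiv.swap i ⟨i.val + 1, hi⟩ j, 1, 1, one_ne_zero, one_ne_zero, Or.inl ⟨?_, ?_⟩⟩
  · change b.permEquiv _ (b.basis _) = _
    simp [permEquiv, u]
  · change b.permEquiv _ (b.basis _) = _
    simp [permEquiv, v]

theorem c_mem_monomial (j : Fin n) : b.c j ∈ b.monomial := by
  intro i
  rcases eq_or_ne i j with rfl | h
  · exact ⟨i, 1, -1, one_ne_zero, neg_ne_zero.2 one_ne_zero,
      Or.inr ⟨by rw [c_u_self, one_smul], by rw [c_v_self, neg_smul, one_smul]⟩⟩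
  · exact ⟨i, 1, 1, one_ne_zero, one_ne_zero,
      Or.inl ⟨by rw [b.c_u_of_ne h, one_smul], by rw [b.c_v_of_ne h, one_smul]⟩⟩

theorem mem_monomial_of_mem_W₂ [Finite K] [Module.Finite K V] {g : Sp form} (hg : g ∈ b.W₂) :
    g ∈ b.monomial := by
  rw [W₂, ← Subgroup.closure_union] at hg
  induction hg using Subgroup.closure_induction with
  | mem x hx =>
    rcases hx with ⟨i, hi, rfl⟩ | ⟨j, rfl⟩
    · exact b.w_mem_monomial i hi
    · exact b.c_mem_monomial j
  | one => exact one_mem _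
  | mul x y _ _ hx hy => exact mul_mem hx hy
  | inv x _ hx =>
    -- `Sp` is finite, so an inverse is a power and closure of the submonoid under products
    -- suffices.
    have h : x⁻¹ ∈ Submonoid.powers x := by
      rw [mem_powers_iff_mem_zpowers]
      exact inv_mem (Subgroup.mem_zpowers x)
    exact (Submonoid.powers_le.2 hx) h

theorem exists_apply_basis_of_mem_monomial {g : Sp form} (hg : g ∈ b.monomial)
    (i : Fin n ⊕ Fin n) :
    ∃ k, ∃ r : K, r ≠ 0 ∧ g.1 (b.basis i) = r • b.basis k := by
  rcases i with i | i <;> obtain ⟨k, r, s, hr, hs, ⟨h1, h2⟩ | ⟨h1, h2⟩⟩ := hg i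
  · exact ⟨_, r, hr, h1⟩
  · exact ⟨_, r, hr, h1⟩
  · exact ⟨_, s, hs, h2⟩
  · exact ⟨_, s, hs, h2⟩

/-- For `n ∈ W₂`, exactly one of `n u` and `n v` lies in `M`. -/
theorem apply_u_mem_M_iff [Finite K] [Module.Finite K V] {g : Sp form} (hg : g ∈ b.W₂)
    (i : Fin n) : g.1 (b.u i) ∈ b.M ↔ g.1 (b.v i) ∉ b.M := by
  obtain ⟨k, r, s, hr, hs, ⟨h1, h2⟩ | ⟨h1, h2⟩⟩ := b.mem_monomial_of_mem_W₂ hg i <;> rw [h1, h2]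
  · simp [Submodule.smul_mem_iff _ hr, Submodule.smul_mem_iff _ hs, u_mem_M, v_notMem_M]
  · simp [Submodule.smul_mem_iff _ hr, Submodule.smul_mem_iff _ hs, u_mem_M, v_notMem_M]

theorem mem_H_of_eigenvectors [Module.Finite K V] {g : Sp form}
    (h : ∀ i, ∃ a : K, g.1 (b.basis i) = a • b.basis i) : g ∈ b.H := by
  refine ⟨⟨?_, ?_⟩, h⟩
  · refine map_equiv_eq_of_le g.1 fun x hx => map_mem_of_span g.1.toLinearMap ?_ hx
    rintro _ ⟨i, rfl⟩
    obtain ⟨a, ha⟩ := h (Sum.inl i)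
    change g.1 (b.basis (Sum.inl i)) ∈ b.M
    rw [ha]
    exact b.M.smul_mem a (b.u_mem_M i)
  · refine map_equiv_eq_of_le g.1 fun x hx => map_mem_of_span g.1.toLinearMap ?_ hx
    rintro _ ⟨i, rfl⟩
    obtain ⟨a, ha⟩ := h (Sum.inr i)
    change g.1 (b.basis (Sum.inr i)) ∈ b.N
    rw [ha]
    exact b.N.smul_mem a (b.v_mem_N i)

theorem conj_mem_H [Finite K] [Module.Finite K V] {g h : Sp form} (hg : g ∈ b.W₂)
    (hh : h ∈ b.H) : g⁻¹ * h * g ∈ b.H := by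
  refine b.mem_H_of_eigenvectors fun i => ?_
  obtain ⟨k, r, hr, hk⟩ := b.exists_apply_basis_of_mem_monomial (b.mem_monomial_of_mem_W₂ hg) i
  obtain ⟨a, ha⟩ := hh.2 k
  refine ⟨a, ?_⟩
  rw [mul_assoc, Sp_mul_apply, Sp_mul_apply, hk, map_smul, ha, smul_comm, ← hk, map_smul,
    Sp_inv_apply_apply]

theorem c_mem_W₂ (j : Fin n) : b.c j ∈ b.W₂ :=
  Subgroup.mem_sup_right (Subgroup.subset_closure ⟨j, rfl⟩)

theorem apply_mem_M_of_mem_H {h : Sp form} (hh : h ∈ b.H) {x : V} :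
    h.1 x ∈ b.M ↔ x ∈ b.M := by
  have hM := hh.1.1
  constructor
  · intro hx
    rw [← hM] at hx
    obtain ⟨y, hy, hyx⟩ := hx
    rwa [← h.1.injective hyx]
  · intro hx
    rw [← hM]
    exact ⟨x, hx, rfl⟩

/-- The conjugate is the transvection along `g⁻¹ uⱼ`; when this vector lies in the isotropic space
`M`, it is orthogonal to `M`. -/
theorem conj_longRoot_mem_SpM {g : Sp form} {j : Fin n} (hg : (g⁻¹).1 (b.u j) ∈ b.M) (t : K) :
    g⁻¹ * b.longRoot j t * g ∈ b.SpM := by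
  intro x hx
  have h : form (b.u j) (g.1 x) = 0 := by
    rw [← inv_inv g, ← form_apply_left]
    exact b.form_eq_zero_of_mem_M hg hx
  rw [mul_assoc, Sp_mul_apply, Sp_mul_apply, longRoot_apply, h, mul_zero, zero_smul, add_zero,
    Sp_inv_apply_apply]

/-- The relation in the rank one subgroup generated by the long root subgroups. -/
theorem exists_c_mul_longRoot_mul_c [Module.Finite K V] (j : Fin n) {t : K} (ht : t ≠ 0) :
    ∃ h ∈ b.H, b.c j * b.longRoot j t * b.c j =
      b.longRoot j (-t⁻¹) * b.c j * h * b.longRoot j (-t⁻¹) := by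
  -- Solve the required identity for `h`. It scales `uⱼ` by `t`, `vⱼ` by `t⁻¹`, and fixes the other
  -- basis vectors.
  refine ⟨(b.c j)⁻¹ * b.longRoot j t⁻¹ * (b.c j * b.longRoot j t * b.c j) * b.longRoot j t⁻¹,
    b.mem_H_of_eigenvectors ?_, ?_⟩
  · rintro (i | i)
    · change ∃ a, ((b.c j)⁻¹ * b.longRoot j t⁻¹ * (b.c j * b.longRoot j t * b.c j) *
        b.longRoot j t⁻¹).1 (b.u i) = a • b.u i
      rcases eq_or_ne i j with rfl | h
      · refine ⟨t, ?_⟩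
        simp only [Sp_mul_apply, longRoot_u, c_u_self, longRoot_v_self, map_add, map_smul,
          c_v_self, map_neg, c_inv_u_self, c_inv_v_self, smul_add, smul_smul, smul_neg]
        rw [mul_inv_cancel₀ ht]
        module
      · refine ⟨1, ?_⟩
        simp only [Sp_mul_apply, longRoot_u, b.c_u_of_ne h, b.c_inv_u_of_ne h, one_smul]
    · change ∃ a, ((b.c j)⁻¹ * b.longRoot j t⁻¹ * (b.c j * b.longRoot j t * b.c j) *
        b.longRoot j t⁻¹).1 (b.v i) = a • b.v i
      rcases eq_or_ne i j with rfl | h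
      · refine ⟨t⁻¹, ?_⟩
        simp only [Sp_mul_apply, longRoot_u, c_u_self, longRoot_v_self, map_add, map_smul,
          c_v_self, map_neg, c_inv_u_self, c_inv_v_self, smul_add, smul_smul, smul_neg, neg_add]
        match_scalars <;> field_simp <;> ring
      · refine ⟨1, ?_⟩
        have h' : ((b.c j)⁻¹).1 (b.v i) = b.v i := by
          have := Sp_inv_apply_apply (b.c j) (b.v i)
          rwa [b.c_v_of_ne h] at this
        simp only [Sp_mul_apply, b.longRoot_v_of_ne h, b.c_v_of_ne h, h', one_smul]
  · have h1 := b.longRoot_neg_mul j t⁻¹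
    have h2 := b.longRoot_mul_neg j t⁻¹
    rw [mul_assoc _ _ (b.longRoot j (-t⁻¹)), mul_assoc _ (b.longRoot j t⁻¹), h2]
    simp only [mul_assoc, mul_inv_cancel_left, mul_one]
    rw [← mul_assoc (b.longRoot j (-t⁻¹)), h1, one_mul]

variable {b} in
theorem rep_inv_mul_mem_H {rep : b.Weyl → b.W₂}
    (hrep : ∀ w : b.Weyl, (QuotientGroup.mk (rep w) : b.Weyl) = w)
    (g : b.W₂) (w : b.Weyl) :
    (rep (g • w) : Sp form)⁻¹ * (g * rep w) ∈ b.H := by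
  have h : (QuotientGroup.mk (rep (g • w)) : b.Weyl) = QuotientGroup.mk (g * rep w) := by
    rw [hrep]
    conv_lhs => rw [← hrep w]
    rfl
  exact Subgroup.mem_subgroupOf.1 (QuotientGroup.eq.1 h)

end Monomial

end SymplecticBasis

end SteinbergSp

namespace SteinbergSp

/-! ### Character sums over `K` with values in characteristic 2 -/

section CharacterSums

variable {K F A : Type*} [Field K] [Field F] [AddCommMonoid A]

/-- The nonzero elements are the disjoint union of `R` and `-R`; disjointness needs `x ≠ -x`, hence
`2 ≠ 0` in `K`. -/
theorem sum_signRepresentatives [Fintype K] [DecidableEq K] (h2 : (2 : K) ≠ 0) {R : Finset K}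
    (hR : IsSignRepresentatives R) (f : K → A) :
    ∑ x ∈ R, (f (-x) + f x) = ∑ x ∈ Finset.univ.erase 0, f x := by
  have hne : ∀ x : K, x ≠ 0 → x ≠ -x := fun x hx h => by
    have h' : 2 * x = 0 := by linear_combination h
    exact (mul_ne_zero h2 hx) h'
  have hR0 : ∀ x ∈ R, x ≠ 0 := fun x hx h => hR.1 (h ▸ hx)
  have hd : Disjoint (R.map (Equiv.neg K).toEmbedding) R := by
    rw [Finset.disjoint_left]
    intro x hx hx'
    obtain ⟨y, hy, hyx⟩ := Finset.mem_map.1 hx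
    have hyx : -y = x := hyx
    have h0 := hR0 x hx'
    obtain ⟨z, -, hz⟩ := hR.2 x h0
    have h1 := hz x ⟨hx', Or.inl rfl⟩
    have h3 := hz y ⟨hy, Or.inr (by rw [← hyx, neg_neg])⟩
    refine hne x h0 ?_
    rw [← h1.trans h3.symm] at hyx
    exact hyx.symm
  have hu : Finset.univ.erase 0 = (R.map (Equiv.neg K).toEmbedding).disjUnion R hd := by
    ext x
    simp only [Finset.mem_erase, Finset.mem_univ, and_true, Finset.mem_disjUnion, Finset.mem_map,
      Equiv.coe_toEmbedding, Equiv.neg_apply]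
    constructor
    · intro hx
      obtain ⟨y, ⟨hy, rfl | rfl⟩, -⟩ := hR.2 x hx
      · exact Or.inr hy
      · exact Or.inl ⟨-x, hy, neg_neg x⟩
    · rintro (⟨y, hy, rfl⟩ | hx)
      · exact neg_ne_zero.2 (hR0 y hy)
      · exact hR0 x hx
  rw [hu, Finset.sum_disjUnion, Finset.sum_map, Finset.sum_add_distrib]
  rfl

/-- In characteristic two, an even function has sum `f 0`: the other terms cancel in pairs. -/
theorem sum_even_eq_zero [Fintype K] [DecidableEq K] [CharP F 2] (h2 : (2 : K) ≠ 0)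
    {R : Finset K} (hR : IsSignRepresentatives R) (f : K → F) (hf : ∀ x, f (-x) = f x) :
    ∑ x, f x = f 0 := by
  rw [← Finset.add_sum_erase _ _ (Finset.mem_univ 0), ← sum_signRepresentatives h2 hR]
  simp [hf, CharTwo.add_self_eq_zero]

/-- Complete the square by the shift `x ↦ x + t⁻¹`. The remaining sum of `λ(-x² t)` is over an even
function, so it equals its value `1` at `0`. -/
theorem sum_lam_quadratic [Fintype K] [CharP F 2] (h2 : (2 : K) ≠ 0)
    {R : Finset K} (hR : IsSignRepresentatives R) {lam : AddChar K F} {t : K} (ht : t ≠ 0) :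
    ∑ x, lam (2 * x - x ^ 2 * t) = lam t⁻¹ := by
  classical
  have h : ∀ x, lam (2 * (x + t⁻¹) - (x + t⁻¹) ^ 2 * t) = lam t⁻¹ * lam (-(x ^ 2 * t)) := by
    intro x
    rw [← AddChar.map_add_eq_mul]
    congr 1
    field_simp
    ring
  rw [← Equiv.sum_comp (Equiv.addRight t⁻¹)]
  simp only [Equiv.coe_addRight, h]
  rw [← Finset.mul_sum, sum_even_eq_zero h2 hR _ (fun x => by rw [neg_sq])]
  simp

theorem sum_lam_two_mul [Fintype K] (h2 : (2 : K) ≠ 0) {lam : AddChar K F} (hlam : lam ≠ 1) :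
    ∑ x, lam (2 * x) = 0 := by
  have h := Equiv.sum_comp (Equiv.mulLeft₀ (2 : K) h2) lam
  rw [AddChar.sum_eq_zero_of_ne_one hlam] at h
  exact h

end CharacterSums

/-! ### The Steinberg element and its rank one relations -/

section Steinberg

attribute [local instance] Fintype.ofFinite

open MonoidAlgebra SymplecticBasis

variable {K V : Type*} [Field K] [AddCommGroup V] [Module K V]
  [Finite K] [Module.Finite K V] {form : LinearMap.BilinForm K V} {n : ℕ}
  (F : Type*) [Field F] (b : SymplecticBasis form n) (rep : b.Weyl → b.W₂)

/-- The sum of the elements of the coset `gB` in the group algebra. -/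
noncomputable def cosetSum (g : Sp form) : MonoidAlgebra F (Sp form) :=
  of F (Sp form) g * ∑ x : b.B, of F (Sp form) x

theorem of_mul_cosetSum (g h : Sp form) :
    of F (Sp form) g * cosetSum F b h = cosetSum F b (g * h) := by
  rw [cosetSum, cosetSum, ← mul_assoc, ← map_mul]

theorem cosetSum_eq {g h : Sp form} (hgh : g⁻¹ * h ∈ b.B) : cosetSum F b g = cosetSum F b h := by
  have key : of F (Sp form) (g⁻¹ * h) * ∑ x : b.B, of F (Sp form) (x : Sp form) =
      ∑ x : b.B, of F (Sp form) (x : Sp form) := by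
    rw [Finset.mul_sum]
    simp only [← map_mul]
    exact Equiv.sum_comp (Equiv.mulLeft (⟨g⁻¹ * h, hgh⟩ : b.B))
      (fun x => of F (Sp form) (x : Sp form))
  rw [cosetSum, ← key, ← mul_assoc, ← map_mul, mul_inv_cancel_left, cosetSum]

/-- The hypothesis says that left multiplication by `y` maps the coset `gB` to itself. -/
theorem of_mul_cosetSum_of_conj_mem {g y : Sp form} (h : g⁻¹ * y * g ∈ b.B) :
    of F (Sp form) y * cosetSum F b g = cosetSum F b g := by
  rw [of_mul_cosetSum]
  exact (cosetSum_eq F b (by rwa [← mul_assoc])).symm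

/-- All signs are `1` in characteristic 2, so the length function drops out. -/
theorem steinbergElement_eq_sum [CharP F 2] :
    steinbergElement F b rep = ∑ w, cosetSum F b (rep w) := by
  rw [steinbergElement, Finset.sum_mul]
  refine Finset.sum_congr rfl fun w _ => ?_
  rw [CharTwo.neg_eq, one_pow, one_smul, cosetSum]

variable {b rep} in
theorem of_mul_cosetSum_rep (hrep : ∀ w : b.Weyl, (QuotientGroup.mk (rep w) : b.Weyl) = w)
    (g : b.W₂) (w : b.Weyl) :
    of F (Sp form) (g : Sp form) * cosetSum F b (rep w) = cosetSum F b (rep (g • w)) := by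
  rw [of_mul_cosetSum]
  exact (cosetSum_eq F b (Subgroup.mem_sup_right (rep_inv_mul_mem_H hrep g w))).symm

open Classical in
/-- The part of the Steinberg element belonging to the `w ∈ W` for which the root `w⁻¹α` is
positive, where `α` is the long root attached to `uⱼ`. -/
noncomputable def positivePart (j : Fin n) : MonoidAlgebra F (Sp form) :=
  ∑ w : b.Weyl with ((rep w : Sp form)⁻¹).1 (b.u j) ∈ b.M, cosetSum F b (rep w)

variable {F b rep} in
-- Modulo `H`, the representative of `cⱼ w` is `cⱼ n_w`, whose inverse takes `uⱼ` to `-n_w⁻¹ vⱼ`;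
-- and exactly one of `n_w⁻¹ uⱼ`, `n_w⁻¹ vⱼ` lies in `M`. So `cⱼ` exchanges the `w` with `w⁻¹α`
-- positive and those with `w⁻¹α` negative.
theorem rep_c_smul_inv_u_mem_M_iff
    (hrep : ∀ w : b.Weyl, (QuotientGroup.mk (rep w) : b.Weyl) = w) (j : Fin n) (w : b.Weyl) :
    ((rep ((⟨b.c j, b.c_mem_W₂ j⟩ : b.W₂) • w) : Sp form)⁻¹).1 (b.u j) ∈ b.M ↔
      ¬ ((rep w : Sp form)⁻¹).1 (b.u j) ∈ b.M := by
  set c : b.W₂ := ⟨b.c j, b.c_mem_W₂ j⟩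
  have hh := rep_inv_mul_mem_H hrep c w
  rw [b.apply_u_mem_M_iff (b.W₂.inv_mem (rep w).2), not_not]
  have h : ((rep (c • w) : Sp form)⁻¹).1 (b.u j) =
      ((rep (c • w) : Sp form)⁻¹ * (c * rep w)).1 (-((rep w : Sp form)⁻¹).1 (b.v j)) := by
    simp only [Sp_mul_apply, map_neg, Sp_apply_inv_apply]
    rw [show (c : Sp form) = b.c j from rfl, c_v_self, map_neg, neg_neg]
  rw [h, b.apply_mem_M_of_mem_H hh, neg_mem_iff]

variable {F b rep} in
theorem steinbergElement_eq_add [CharP F 2]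
    (hrep : ∀ w : b.Weyl, (QuotientGroup.mk (rep w) : b.Weyl) = w) (j : Fin n) :
    steinbergElement F b rep =
      positivePart F b rep j + of F (Sp form) (b.c j) * positivePart F b rep j := by
  classical
  rw [steinbergElement_eq_sum, ← Finset.sum_filter_add_sum_filter_not _
    (fun w : b.Weyl => ((rep w : Sp form)⁻¹).1 (b.u j) ∈ b.M), positivePart]
  congr 1
  · refine Finset.sum_congr ?_ fun _ _ => rfl
    ext w
    simp
  · rw [Finset.mul_sum]
    symm
    refine Finset.sum_equiv (MulAction.toPerm (⟨b.c j, b.c_mem_W₂ j⟩ : b.W₂)) ?_ ?_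
    · intro w
      simp only [Finset.mem_filter, Finset.mem_univ, true_and, MulAction.toPerm_apply]
      rw [rep_c_smul_inv_u_mem_M_iff hrep, not_not]
    · intro w _
      exact of_mul_cosetSum_rep F hrep ⟨b.c j, b.c_mem_W₂ j⟩ w

/-- Positivity of `w⁻¹α` puts the conjugate of the root element by `n_w` into `Sp^M ≤ B`, where the
sum over `B` absorbs it. -/
theorem longRoot_mul_positivePart (j : Fin n) (t : K) :
    of F (Sp form) (b.longRoot j t) * positivePart F b rep j = positivePart F b rep j := by
  rw [positivePart, Finset.mul_sum]
  refine Finset.sum_congr rfl fun w hw => of_mul_cosetSum_of_conj_mem F b ?_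
  have hw : ((rep w : Sp form)⁻¹).1 (b.u j) ∈ b.M := by simpa using hw
  exact Subgroup.mem_sup_left (Subgroup.mem_sup_right (b.conj_longRoot_mem_SpM hw t))

theorem H_mul_positivePart (j : Fin n) {h : Sp form} (hh : h ∈ b.H) :
    of F (Sp form) h * positivePart F b rep j = positivePart F b rep j := by
  rw [positivePart, Finset.mul_sum]
  refine Finset.sum_congr rfl fun w _ => of_mul_cosetSum_of_conj_mem F b ?_
  exact Subgroup.mem_sup_right (b.conj_mem_H (rep w).2 hh)

variable {F b rep} in
-- Left multiplication by `cⱼ` permutes the coset sums; the usual sign is invisible in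
-- characteristic 2.
theorem c_mul_steinbergElement [CharP F 2]
    (hrep : ∀ w : b.Weyl, (QuotientGroup.mk (rep w) : b.Weyl) = w) (j : Fin n) :
    of F (Sp form) (b.c j) * steinbergElement F b rep = steinbergElement F b rep := by
  rw [steinbergElement_eq_sum, Finset.mul_sum]
  refine Eq.trans (Finset.sum_congr rfl fun w _ =>
    of_mul_cosetSum_rep F hrep ⟨b.c j, b.c_mem_W₂ j⟩ w) ?_
  exact Equiv.sum_comp (MulAction.toPerm (⟨b.c j, b.c_mem_W₂ j⟩ : b.W₂))
    (fun w => cosetSum F b (rep w))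

variable {F b rep} in
/-- Steinberg's relation between a fundamental reflection and its root subgroup. -/
theorem c_mul_longRoot_mul_steinbergElement [CharP F 2]
    (hrep : ∀ w : b.Weyl, (QuotientGroup.mk (rep w) : b.Weyl) = w) (j : Fin n) {t : K}
    (ht : t ≠ 0) :
    of F (Sp form) (b.c j) * (of F (Sp form) (b.longRoot j t) * steinbergElement F b rep) =
      steinbergElement F b rep +
        of F (Sp form) (b.longRoot j (-t⁻¹)) * steinbergElement F b rep := by
  obtain ⟨h, hh, hc⟩ := b.exists_c_mul_longRoot_mul_c j ht
  have hc' := congrArg (fun x => of F (Sp form) x * positivePart F b rep j) hc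
  simp only [map_mul, mul_assoc] at hc'
  rw [longRoot_mul_positivePart, H_mul_positivePart F b rep j hh] at hc'
  -- With `P` the positive part, the left side is `cP + x(-1/t) cP`, while the right side is `P + cP
  -- + P + x(-1/t) cP`; the two copies of `P` cancel.
  have hE : positivePart F b rep j + positivePart F b rep j = 0 := by
    rw [← two_smul F, CharTwo.two_eq_zero, zero_smul]
  rw [steinbergElement_eq_add hrep j, mul_add, mul_add, mul_add, hc',
    longRoot_mul_positivePart, longRoot_mul_positivePart]
  rw [show ∀ x y z : MonoidAlgebra F (Sp form), x + y + (x + z) = (x + x) + (y + z) from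
    fun x y z => by abel, hE, zero_add]

end Steinberg

end SteinbergSp

/-! ### Reduction of the vectors `e_σ` to the long root subgroup -/

namespace SteinbergSp

theorem chi_mul_longRoot {K V F : Type*} [Field K] [AddCommGroup V] [Module K V]
    [Module.Finite K V] [Field F] {form : LinearMap.BilinForm K V} {n : ℕ}
    (b : SymplecticBasis form n) (lam : AddChar K F) {last : Fin n} (r : K) {g : Sp form}
    (hg : g ∈ b.radical last) (t : K) :
    chi lam (r • b.v last) (g * b.longRoot last t) = lam (r ^ 2 * t) := by
  rw [chi]
  congr 1
  rw [map_smul, map_smul, map_smul, LinearMap.smul_apply, b.form_mul_longRoot hg.1, hg.2,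
    zero_add, smul_eq_mul, smul_eq_mul]
  ring

section Steinberg

attribute [local instance] Fintype.ofFinite

open MonoidAlgebra SymplecticBasis

variable {K V : Type*} [Field K] [AddCommGroup V] [Module K V]
  [Finite K] [Module.Finite K V] {form : LinearMap.BilinForm K V} {n : ℕ}
  {F : Type*} [Field F] (b : SymplecticBasis form n) (rep : b.Weyl → b.W₂)

variable (F) in
/-- The sum of the elements of the radical in the group algebra. -/
noncomputable def radicalSum (last : Fin n) : MonoidAlgebra F (Sp form) :=
  ∑ x : b.radical last, of F (Sp form) x

variable (F) in
-- Conjugation by `c` is an injective self-map of the finite radical, hence permutes it.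
theorem c_mul_radicalSum {last : Fin n} (hlast : last.val + 1 = n) :
    of F (Sp form) (b.c last) * radicalSum F b last =
      radicalSum F b last * of F (Sp form) (b.c last) := by
  let f : b.radical last → b.radical last := fun g =>
    ⟨b.c last * g * (b.c last)⁻¹, b.conj_c_mem_radical hlast g.2⟩
  have hf : Function.Injective f := fun g h hgh => by
    have := congrArg Subtype.val hgh
    exact Subtype.ext (mul_left_cancel (mul_right_cancel this))
  have hb : Function.Bijective f := Finite.injective_iff_bijective.1 hf
  rw [radicalSum, Finset.mul_sum, Finset.sum_mul,
    ← hb.sum_comp fun g => of F (Sp form) (g : Sp form) * of F (Sp form) (b.c last)]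
  refine Finset.sum_congr rfl fun g _ => ?_
  rw [← map_mul, ← map_mul]
  congr 1
  exact (inv_mul_cancel_right (b.c last * (g : Sp form)) (b.c last)).symm

/-- The vector `e_σ` for a character `σ` of `U` which is trivial on the radical. -/
theorem coe_eSigma (σ : Sp form → F) (last : Fin n) (φ : K → F)
    (hσ : ∀ g ∈ b.radical last, ∀ t, σ (g * b.longRoot last t) = φ t) :
    (eSigma b rep σ : MonoidAlgebra F (Sp form)) =
      radicalSum F b last * ∑ t, (φ t)⁻¹ •
        (of F (Sp form) (b.longRoot last t) * steinbergElement F b rep) := by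
  rw [eSigma, ← (b.radicalProdEquiv last).sum_comp, Fintype.sum_prod_type, radicalSum,
    Finset.sum_mul, AddSubmonoidClass.coe_finsetSum]
  refine Finset.sum_congr rfl fun g _ => ?_
  rw [Finset.mul_sum, AddSubmonoidClass.coe_finsetSum]
  refine Finset.sum_congr rfl fun t _ => ?_
  have h : ((b.radicalProdEquiv last (g, t) : b.U) : Sp form) = g * b.longRoot last t := rfl
  rw [h, hσ g g.2, Submodule.coe_smul_of_tower, Submodule.coe_smul, smul_eq_mul, map_mul, mul_assoc,
    mul_smul_comm]
  rfl

variable {rep} in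
-- Every `t`, including `t = 0`, contributes `λ(-t) e`, and these add up to zero because `λ` is
-- non-trivial. Only the terms `λ(-t) x(-1/t) e` with `t ≠ 0` survive.
theorem c_mul_sum_lam_longRoot [CharP F 2]
    (hrep : ∀ w : b.Weyl, (QuotientGroup.mk (rep w) : b.Weyl) = w) {lam : AddChar K F}
    (hlam : lam ≠ 1) (j : Fin n) [DecidableEq K] :
    of F (Sp form) (b.c j) * ∑ t, lam (-t) •
        (of F (Sp form) (b.longRoot j t) * steinbergElement F b rep) =
      ∑ t ∈ Finset.univ.erase 0, lam t⁻¹ •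
        (of F (Sp form) (b.longRoot j t) * steinbergElement F b rep) := by
  have hsum : ∑ t : K, lam (-t) = 0 := by
    rw [← AddChar.sum_eq_zero_of_ne_one hlam]
    exact Equiv.sum_comp (Equiv.neg K) lam
  rw [Finset.mul_sum, ← Finset.add_sum_erase _ _ (Finset.mem_univ 0), longRoot_zero, map_one,
    one_mul, mul_smul_comm, c_mul_steinbergElement hrep]
  have h1 : ∀ t ∈ Finset.univ.erase (0 : K), of F (Sp form) (b.c j) * lam (-t) •
        (of F (Sp form) (b.longRoot j t) * steinbergElement F b rep) =
      lam (-t) • steinbergElement F b rep + lam (-t) •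
        (of F (Sp form) (b.longRoot j (-t⁻¹)) * steinbergElement F b rep) := by
    intro t ht
    rw [mul_smul_comm, c_mul_longRoot_mul_steinbergElement hrep j (Finset.ne_of_mem_erase ht),
      smul_add]
  rw [Finset.sum_congr rfl h1, Finset.sum_add_distrib, ← add_assoc,
    Finset.add_sum_erase _ (fun t => lam (-t) • steinbergElement F b rep) (Finset.mem_univ 0),
    ← Finset.sum_smul, hsum, zero_smul, zero_add]
  -- The involution `t ↦ -1/t` of the nonzero elements turns `λ(-t) x(-1/t)` into `λ(1/t) x(t)`.
  refine Finset.sum_nbij' (fun t => -t⁻¹) (fun t => -t⁻¹) ?_ ?_ ?_ ?_ ?_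
  · simp
  · simp
  · simp [inv_neg]
  · simp [inv_neg]
  · simp [inv_neg]

end Steinberg

end SteinbergSp

/-! ### Comparison of the coefficients of the `x(t) e` -/

open SteinbergSp in
theorem mainTheorem4 {K V F : Type*} [Field K] [Finite K] (p : ℕ) [Fact p.Prime] [CharP K p]
    (hp : Odd p) [AddCommGroup V] [Module K V] [Module.Finite K V]
    (form : LinearMap.BilinForm K V) (n : ℕ) (b : SymplecticBasis form n)
    [Field F] [CharP F 2] (lam : AddChar K F) (hlam : lam ≠ 1)
    (rep : b.Weyl → b.W₂) (hrep : ∀ w : b.Weyl, (QuotientGroup.mk (rep w) : b.Weyl) = w)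
    (Tq : Finset K) (hTq : IsSignRepresentatives Tq) (last : Fin n) (hlast : last.val + 1 = n) :
    MonoidAlgebra.of F (Sp form) (b.c last) • eSigma b rep (chi lam (b.v last)) =
      eSigma b rep (fun _ => 1) +
        ∑ β ∈ Tq, (lam (-2 * β) + lam (2 * β)) • eSigma b rep (chi lam (β • b.v last)) := by
  classical
  let _ : Fintype K := Fintype.ofFinite K
  have h2 : (2 : K) ≠ 0 := by
    refine Ring.two_ne_zero ?_
    rw [ringChar.eq K p]
    rintro rfl
    exact absurd hp (by decide)
  set X : K → MonoidAlgebra F (Sp form) := fun t =>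
    MonoidAlgebra.of F (Sp form) (b.longRoot last t) * steinbergElement F b rep
  have hchi : ∀ β : K, (eSigma b rep (chi lam (β • b.v last)) : MonoidAlgebra F (Sp form)) =
      radicalSum F b last * ∑ t, lam (-(β ^ 2 * t)) • X t := by
    intro β
    rw [coe_eSigma b rep _ last (fun t => lam (β ^ 2 * t))
      fun g hg t => chi_mul_longRoot b lam β hg t]
    simp only [← AddChar.map_neg_eq_inv]
    rfl
  have hone : (eSigma b rep (fun _ => (1 : F)) : MonoidAlgebra F (Sp form)) =
      radicalSum F b last * ∑ t, X t := by
    rw [coe_eSigma b rep _ last (fun _ => 1) fun g hg t => rfl]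
    simp only [inv_one, one_smul]
    rfl
  have hlhs := hchi 1
  simp only [one_smul, one_pow, one_mul] at hlhs
  apply Subtype.ext
  rw [Submodule.coe_smul, smul_eq_mul, hlhs, ← mul_assoc, c_mul_radicalSum F b hlast, mul_assoc,
    c_mul_sum_lam_longRoot b hrep hlam last, Submodule.coe_add, hone,
    AddSubmonoidClass.coe_finsetSum]
  simp only [Submodule.coe_smul_of_tower, hchi, ← mul_smul_comm]
  rw [← Finset.mul_sum, ← mul_add]
  congr 1
  -- As `β²` does not see the sign of `β`, the two summands `λ(∓2β)` are the contributions of `-β`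
  -- and `β` to one sum over all nonzero `β`.
  have h3 : ∑ β ∈ Tq, (lam (-2 * β) + lam (2 * β)) • ∑ t, lam (-(β ^ 2 * t)) • X t =
      ∑ β ∈ Finset.univ.erase 0, ∑ t, lam (2 * β - β ^ 2 * t) • X t := by
    rw [← sum_signRepresentatives h2 hTq]
    refine Finset.sum_congr rfl fun β _ => ?_
    rw [add_smul, Finset.smul_sum, Finset.smul_sum]
    congr 1 <;>
    · refine Finset.sum_congr rfl fun t _ => ?_
      rw [smul_smul, ← AddChar.map_add_eq_mul]
      congr 2
      ring
  -- The vector `e_1` supplies the missing term `β = 0`.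
  have h4 : ∑ t, X t = ∑ t, lam (2 * 0 - 0 ^ 2 * t) • X t := by simp
  rw [h3, h4, Finset.add_sum_erase _ (fun β => ∑ t, lam (2 * β - β ^ 2 * t) • X t)
    (Finset.mem_univ 0), Finset.sum_comm]
  simp only [← Finset.sum_smul]
  -- Split off `t = 0`: its coefficient `∑ λ(2β)` vanishes, matching the absence of `t = 0` on the
  -- other side.
  rw [← Finset.add_sum_erase _ _ (Finset.mem_univ 0)]
  simp only [mul_zero, sub_zero, sum_lam_two_mul h2 hlam, zero_smul, zero_add]
  refine Finset.sum_congr rfl fun t ht => ?_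
  rw [sum_lam_quadratic h2 hTq (Finset.ne_of_mem_erase ht), mul_smul_comm]
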